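/- **Setting.** Let $p\ge 3$ be a prime and let $\mathfrak G$ be a $p$-adic Vilenkin group: a locally compact abelian group $(\mathfrak G,\dot+)$ with open subgroups $\cdots\supset\mathfrak G_n\supset\mathfrak G_{n+1}\supset\cdots$ ($n\in\mathbb Z$) that form a base of neighbourhoods of $0$, with $\bigcup_n\mathfrak G_n=\mathfrak G$, $\bigcap_n\mathfrak G_n=\{0\}$ and $|\mathfrak G_n/\mathfrak G_{n+1}|=p$ for all $n$, together with fixed elements $g_n\in\mathfrak G_n\setminus\mathfrak G_{n+1}$ such that $pg_n=0$. Every $x\in\mathfrak G$ is uniquely $x=\sum_n a_ng_n$ with $a_n\in\{0,\dots,p-1\}$ and only finitely many $a_n\neq0$ with $n<0$; put $\mathcal Ax=\sum_n a_ng_{n-1}$. Let $X$ be the group of continuous characters $\chi$ of $\mathfrak G$, with values $(\chi,x)$; let $\mathfrak G_n^\perp$ be the annihilator of $\mathfrak G_n$, let $r_n\in X$ be given by $(r_n,\sum_k a_kg_k)=e^{2\pi i a_n/p}$, and let $(\chi\mathcal A^{\pm1},x)=(\chi,\mathcal A^{\pm1}x)$. **Definitions.** Let $M\ge1$. * A set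 $E\subset X$ is *$(1,M)$-elementary* if it is a disjoint union of $p$ cosets $\mathfrak G_{-1}^\perp r_{-1}^{j}\eta_j$, $j=0,\dots,p-1$, where each $\eta_j$ is of the form $r_0^{\alpha_0}\cdots r_{M-1}^{\alpha_{M-1}}$ with $\alpha_\nu\in\{0,\dots,p-1\}$, and $E\cap(\mathfrak G_{l}^\perp\setminus\mathfrak G_{l-1}^\perp)\ne\emptyset$ for $l=0,1,\dots,M$. * $\mathfrak D_{-1}(\mathfrak G_M^\perp)$ is the set of functions $X\to\mathbb C$ that vanish outside $\mathfrak G_M^\perp$ and are constant on the cosets of $\mathfrak G_{-1}^\perp$. * A *$1$-elementary mask* is a function $m_0:X\to\mathbb C$ of the form $m_0(\chi)=\frac1p\sum_{h}\beta_h\overline{(\chi\mathcal A^{-1},h)}$, with $\beta_h\in\mathbb C$ and $h$ running over the $p^2$ elements $a_{-1}g_{-1}\dot+a_{-2}g_{-2}$, $a_{-1},a_{-2}\in\{0,\dots,p-1\}$, which is constant on the cosets of $\mathfrak G_{-1}^\perp$, satisfies $|m_0(\chi)|\in\{0,1\}$ for all $\chi$, and equals $1$ on $\mathfrak G_{-1}^\perp$.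 * Let $T$ be a tree on the vertex set $\{0,\dots,p-1\}$, rooted at $0$. Its *height* is the largest number of vertices of a path starting at the root. Let $\tilde E$ be the union of $\mathfrak G_{-1}^\perp$ and of all cosets $\mathfrak G_{-1}^\perp r_{-1}^{i}r_0^{j}$ such that $j,i$ are consecutive vertices, in this order, of a path of $T$ starting at the root, and let $\tilde E_X=\bigcup_{s\ge1}\bigcup_{\alpha_1,\dots,\alpha_s=0}^{p-1}\tilde E\,r_1^{\alpha_1}\cdots r_s^{\alpha_s}$. The tree $T$ *generates* the set $\bigcap_{n=0}^\infty\tilde E_X\mathcal A^n$. **Theorem.** Let $p\ge3$ be a prime, $M\ge1$, and let $E\subset\mathfrak G_M^\perp$ be a $(1,M)$-elementary set. Suppose that $\hat\varphi\in\mathfrak D_{-1}(\mathfrak G_M^\perp)$, that $|\hat\varphi|=\mathbf 1_E$ on $X$, and that $$\hat\varphi(\chi)=m_0(\chi)\,\hat\varphi(\chi\mathcal A^{-1})\qquad(\chi\in X)$$ with a $1$-elementary mask $m_0$. Then there is a tree on $\{0,1,\dots,p-1\}$, rooted at $0$, of height $M+2$, that generates $E$. -/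

import Mathlib

open Filter Topology

/-- The data of a `p`-adic Vilenkin group on a topological abelian group `G`: a basic chain
`⋯ ⊇ G_n ⊇ G_{n+1} ⊇ ⋯` (`n ∈ ℤ`) of open subgroups which is a base of neighbourhoods of zero, has
union `G`, intersection `{0}` and all indices `[G_n : G_{n+1}]` equal to `p`, together with a basic
system `g_n ∈ G_n \ G_{n+1}` such that `p g_n = 0`.  (Local compactness of `G` is a type class.) -/
structure BasicSystem (p : ℕ) (G : Type*) [AddCommGroup G] [TopologicalSpace G] where
  /-- the subgroup `G_n` -/
  sub : ℤ → AddSubgroup G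
  sub_succ_le : ∀ n, sub (n + 1) ≤ sub n
  isOpen_sub : ∀ n, IsOpen (sub n : Set G)
  exists_sub_subset : ∀ U ∈ 𝓝 (0 : G), ∃ n, (sub n : Set G) ⊆ U
  iUnion_sub : ⋃ n, (sub n : Set G) = Set.univ
  iInter_sub : ⋂ n, (sub n : Set G) = {0}
  relIndex_sub : ∀ n, (sub (n + 1)).relIndex (sub n) = p
  /-- the element `g_n` -/
  g : ℤ → G
  g_mem : ∀ n, g n ∈ sub n
  g_notMem : ∀ n, g n ∉ sub (n + 1)
  nsmul_g : ∀ n, p • g n = 0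

/-- Digit sequences `(a_n)` with only finitely many nonzero terms of negative index. -/
def digitSpace (p : ℕ) : AddSubgroup (ℤ → ZMod p) where
  carrier := {a | ∃ m, ∀ n < m, a n = 0}
  zero_mem' := ⟨0, fun _ _ => rfl⟩
  add_mem' := by
    rintro a b ⟨m, hm⟩ ⟨k, hk⟩
    refine ⟨min m k, fun n hn => ?_⟩
    rw [Pi.add_apply, hm n (lt_of_lt_of_le hn (min_le_left _ _)),
      hk n (lt_of_lt_of_le hn (min_le_right _ _)), add_zero]
  neg_mem' := by
    rintro a ⟨m, hm⟩
    exact ⟨m, fun n hn => by rw [Pi.neg_apply, hm n hn, neg_zero]⟩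

/-- The shift `(a_n) ↦ (a_{n+1})` of digit sequences. -/
def digitShift (p : ℕ) : digitSpace p ≃+ digitSpace p where
  toFun a := ⟨fun n => a.1 (n + 1), by
    obtain ⟨m, hm⟩ := a.2
    exact ⟨m - 1, fun n hn => hm _ (by omega)⟩⟩
  invFun a := ⟨fun n => a.1 (n - 1), by
    obtain ⟨m, hm⟩ := a.2
    exact ⟨m + 1, fun n hn => hm _ (by omega)⟩⟩
  left_inv a := by
    ext n
    simp
  right_inv a := by
    ext n
    simp
  map_add' _ _ := rfl

namespace BasicSystem

section expansions

variable {p : ℕ} {G : Type*} [AddCommGroup G] [TopologicalSpace G] (S : BasicSystem p G)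

theorem sub_anti {m n : ℤ} (h : m ≤ n) : S.sub n ≤ S.sub m :=
  antitone_int_of_succ_le S.sub_succ_le h

theorem mod_smul_g (k : ℕ) (n : ℤ) : (k % p) • S.g n = k • S.g n := by
  conv_rhs => rw [← Nat.mod_add_div k p, add_smul, mul_comm, mul_smul, S.nsmul_g, smul_zero,
    add_zero]

theorem sub_sum_mem [IsTopologicalAddGroup G] {f : ℤ → G} {y : G} (hf : HasSum f y)
    (s : Finset ℤ) (n : ℤ) (h : ∀ i ∉ s, f i ∈ S.sub n) : y - ∑ i ∈ s, f i ∈ S.sub n := by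
  have hc : IsClosed (S.sub n : Set G) := (S.sub n).isClosed_of_isOpen (S.isOpen_sub n)
  refine hc.mem_of_tendsto (hf.sub_const (∑ i ∈ s, f i)) ?_
  filter_upwards [eventually_ge_atTop s] with t ht
  rw [← Finset.sum_sdiff (show s ⊆ t from ht), add_sub_cancel_right]
  exact (S.sub n).sum_mem fun i hi => h i (Finset.mem_sdiff.1 hi).2

theorem t2 [IsTopologicalAddGroup G] (S : BasicSystem p G) : T2Space G := by
  have h : IsClosed ({0} : Set G) := by
    rw [← S.iInter_sub]
    exact isClosed_iInter fun n => (S.sub n).isClosed_of_isOpen (S.isOpen_sub n)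
  have h1 : T1Space G := IsTopologicalAddGroup.t1Space G h
  infer_instance

theorem summable_digits [IsTopologicalAddGroup G] [LocallyCompactSpace G] (a : digitSpace p) :
    Summable fun n => (a.1 n).val • S.g n := by
  let _ : UniformSpace G := IsTopologicalAddGroup.rightUniformSpace G
  have _ : IsUniformAddGroup G := isUniformAddGroup_of_addCommGroup
  have _ : CompleteSpace G := IsRightUniformAddGroup.completeSpace_of_weaklyLocallyCompactSpace
  have _ : NonarchimedeanAddGroup G := ⟨fun U hU => by
    obtain ⟨n, hn⟩ := S.exists_sub_subset U hU
    exact ⟨⟨S.sub n, S.isOpen_sub n⟩, hn⟩⟩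
  apply NonarchimedeanAddGroup.summable_of_tendsto_cofinite_zero
  intro U hU
  obtain ⟨n, hn⟩ := S.exists_sub_subset U hU
  obtain ⟨m, hm⟩ := a.2
  rw [mem_map, mem_cofinite]
  refine (Set.finite_Ico m n).subset fun k hk => ?_
  by_contra hk2
  apply hk
  rw [Set.mem_Ico, not_and_or, not_le, not_lt] at hk2
  rcases hk2 with h | h
  · simp only [Set.mem_preimage, hm k h, ZMod.val_zero, zero_smul]
    exact mem_of_mem_nhds hU
  · exact hn ((S.sub n).nsmul_mem (S.sub_anti h (S.g_mem k)) _)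

variable [Fact p.Prime]

theorem val_add_smul (a b : ZMod p) (n : ℤ) :
    (a + b).val • S.g n = a.val • S.g n + b.val • S.g n := by
  rw [ZMod.val_add, mod_smul_g, add_smul]

theorem val_sub_smul (a b : ZMod p) (n : ℤ) :
    (a - b).val • S.g n = a.val • S.g n - b.val • S.g n := by
  rw [eq_sub_iff_add_eq, ← val_add_smul, sub_add_cancel]

theorem val_smul_mem_iff (a : ZMod p) (n : ℤ) : a.val • S.g n ∈ S.sub (n + 1) ↔ a = 0 := by
  constructor
  · intro h
    by_contra ha
    apply S.g_notMem n
    have h1 := (S.sub (n + 1)).nsmul_mem h (a⁻¹).val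
    rwa [← mul_smul, ← mod_smul_g, ← ZMod.val_mul, inv_mul_cancel₀ ha, ZMod.val_one, one_smul]
      at h1
  · rintro rfl
    simp

theorem exists_digit (n : ℤ) (x : G) (hx : x ∈ S.sub n) :
    ∃ a : ZMod p, x - a.val • S.g n ∈ S.sub (n + 1) := by
  let K := (S.sub (n + 1)).addSubgroupOf (S.sub n)
  have hK : Nat.card (S.sub n ⧸ K) = p := S.relIndex_sub n
  have hg (a : ZMod p) : a.val • S.g n ∈ S.sub n := (S.sub n).nsmul_mem (S.g_mem n) _
  let f : ZMod p → S.sub n ⧸ K := fun a => QuotientAddGroup.mk ⟨a.val • S.g n, hg a⟩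
  have hf : Function.Injective f := by
    intro a b hab
    have h1 := QuotientAddGroup.eq.1 hab
    have h2 : -(a.val • S.g n) + b.val • S.g n ∈ S.sub (n + 1) := h1
    rw [neg_add_eq_sub, ← val_sub_smul, val_smul_mem_iff, sub_eq_zero] at h2
    exact h2.symm
  have _ : Finite (S.sub n ⧸ K) := Nat.finite_of_card_ne_zero (by
    rw [hK]; exact (Fact.out : p.Prime).ne_zero)
  have hb := hf.bijective_of_nat_card_le (by rw [hK, Nat.card_zmod])
  obtain ⟨a, ha⟩ := hb.2 (QuotientAddGroup.mk ⟨x, hx⟩)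
  have h1 := QuotientAddGroup.eq.1 (show QuotientAddGroup.mk (s := K) ⟨a.val • S.g n, hg a⟩ =
    QuotientAddGroup.mk ⟨x, hx⟩ from ha)
  have h2 : -(a.val • S.g n) + x ∈ S.sub (n + 1) := h1
  exact ⟨a, by rwa [neg_add_eq_sub] at h2⟩

variable [IsTopologicalAddGroup G] [LocallyCompactSpace G]

/-- The homomorphism `(a_n) ↦ ∑ a_n g_n`. -/
noncomputable def ofDigits : digitSpace p →+ G :=
  AddMonoidHom.mk' (fun a => ∑' n, (a.1 n).val • S.g n) fun a b => by
    have _ := S.t2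
    rw [← (S.summable_digits a).tsum_add (S.summable_digits b)]
    exact tsum_congr fun n => S.val_add_smul _ _ _

theorem hasSum_ofDigits (a : digitSpace p) :
    HasSum (fun n => (a.1 n).val • S.g n) (S.ofDigits a) :=
  (S.summable_digits a).hasSum

/-- `∑ a_n g_n` lies in `G_m` exactly when `a_n = 0` for all `n < m`. -/
theorem ofDigits_mem_iff (a : digitSpace p) (m : ℤ) :
    S.ofDigits a ∈ S.sub m ↔ ∀ n < m, a.1 n = 0 := by
  constructor
  · intro h
    obtain ⟨k, hk⟩ := a.2
    have key : ∀ j : ℕ, k + j < m → a.1 (k + j) = 0 := by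
      intro j
      induction j using Nat.strong_induction_on with
      | _ j ih =>
        intro hjm
        have h0 : ∀ i < k + (j : ℤ), a.1 i = 0 := fun i hi => by
          by_cases hik : i < k
          · exact hk i hik
          · have h2 := ih (i - k).toNat (by omega) (by omega)
            rwa [show k + ((i - k).toNat : ℤ) = i by omega] at h2
        have h1 := S.sub_sum_mem (S.hasSum_ofDigits a) {k + (j : ℤ)} (k + (j : ℤ) + 1) (by
          intro i hi
          rw [Finset.mem_singleton] at hi
          rcases lt_or_gt_of_ne hi with h2 | h2
          · simp [h0 i h2]
          · exact (S.sub _).nsmul_mem (S.sub_anti (by omega) (S.g_mem i)) _)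
        rw [Finset.sum_singleton] at h1
        have h2 := (S.sub (k + (j : ℤ) + 1)).sub_mem (S.sub_anti (by omega) h) h1
        rwa [sub_sub_cancel, val_smul_mem_iff] at h2
    intro n hnm
    by_cases hnk : n < k
    · exact hk n hnk
    · have h2 := key (n - k).toNat (by omega)
      rwa [show k + ((n - k).toNat : ℤ) = n by omega] at h2
  · intro h
    have h1 := S.sub_sum_mem (S.hasSum_ofDigits a) ∅ m (by
      intro i _
      by_cases him : i < m
      · simp [h i him]
      · exact (S.sub m).nsmul_mem (S.sub_anti (not_lt.1 him) (S.g_mem i)) _)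
    simpa using h1

theorem ofDigits_injective : Function.Injective S.ofDigits := by
  rw [injective_iff_map_eq_zero]
  intro a ha
  ext n
  exact (S.ofDigits_mem_iff a (n + 1)).1 (by rw [ha]; exact zero_mem _) n (by omega)

theorem ofDigits_surjective : Function.Surjective S.ofDigits := by
  intro x
  have hx : x ∈ ⋃ n, (S.sub n : Set G) := by rw [S.iUnion_sub]; trivial
  obtain ⟨m, hm⟩ := Set.mem_iUnion.1 hx
  have hd : ∀ (n : ℤ) (y : G), ∃ b : ZMod p, y ∈ S.sub n → y - b.val • S.g n ∈ S.sub (n + 1) := by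
    intro n y
    by_cases hy : y ∈ S.sub n
    · obtain ⟨b, hb⟩ := S.exists_digit n y hy
      exact ⟨b, fun _ => hb⟩
    · exact ⟨0, fun h => absurd h hy⟩
  choose d hd using hd
  let rem : ℕ → G := fun k =>
    Nat.rec (motive := fun _ => G) x (fun k y => y - (d (m + k) y).val • S.g (m + k)) k
  have hrem (k : ℕ) : rem (k + 1) = rem k - (d (m + k) (rem k)).val • S.g (m + k) := rfl
  have hmem (k : ℕ) : rem k ∈ S.sub (m + k) := by
    induction k with
    | zero =>
      rw [Nat.cast_zero, add_zero]
      exact hm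
    | succ k ih =>
      rw [hrem]
      have := hd _ _ ih
      push_cast
      rwa [← add_assoc]
  let a : digitSpace p := ⟨fun n => if n < m then 0 else d n (rem (n - m).toNat),
    ⟨m, fun n hn => if_pos hn⟩⟩
  have ha (k : ℕ) : a.1 (m + k) = d (m + k) (rem k) := by
    have h1 : ¬ (m + (k : ℤ) < m) := by omega
    have h2 : (m + (k : ℤ) - m).toNat = k := by omega
    simp only [a, if_neg h1, h2]
  let e : ℕ ↪ ℤ := ⟨fun i => m + (i : ℤ), fun i j h => by
    have h2 : m + (i : ℤ) = m + (j : ℤ) := h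
    omega⟩
  have he (i : ℕ) : e i = m + (i : ℤ) := rfl
  have hsum (k : ℕ) : rem k = x - ∑ i ∈ (Finset.range k).map e, (a.1 i).val • S.g i := by
    rw [Finset.sum_map]
    induction k with
    | zero => simp [rem]
    | succ k ih =>
      rw [hrem, Finset.sum_range_succ, ← sub_sub, ← ih]
      simp only [he, ha]
  refine ⟨a, ?_⟩
  have hall : ∀ k : ℕ, S.ofDigits a - x ∈ S.sub (m + k) := by
    intro k
    have h1 := S.sub_sum_mem (S.hasSum_ofDigits a) ((Finset.range k).map e) (m + k) (by
        intro i hi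
        by_cases him : i < m
        · simp [a, him]
        · apply (S.sub (m + k)).nsmul_mem
          apply S.sub_anti _ (S.g_mem i)
          by_contra hlt
          apply hi
          rw [Finset.mem_map]
          exact ⟨(i - m).toNat, Finset.mem_range.2 (by omega), by
            rw [he]; omega⟩)
    have h2 := (S.sub (m + k)).sub_mem h1 (hmem k)
    rwa [hsum k, sub_sub_sub_cancel_right] at h2
  have hz : S.ofDigits a - x ∈ ⋂ n, (S.sub n : Set G) := by
    rw [Set.mem_iInter]
    intro n
    exact S.sub_anti (by omega) (hall (n - m).toNat)
  rw [S.iInter_sub] at hz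
  exact sub_eq_zero.1 hz

/-- Every `x ∈ G` is `∑ a_n g_n` for exactly one digit sequence. -/
noncomputable def digitEquiv : digitSpace p ≃+ G :=
  AddEquiv.ofBijective S.ofDigits ⟨S.ofDigits_injective, S.ofDigits_surjective⟩

/-- The digit `a_n` of `x = ∑ a_n g_n`. -/
noncomputable def digit (x : G) (n : ℤ) : ZMod p := (S.digitEquiv.symm x).1 n

theorem hasSum_digit (x : G) : HasSum (fun n => (S.digit x n).val • S.g n) x := by
  have h := S.hasSum_ofDigits (S.digitEquiv.symm x)
  have h2 : S.ofDigits (S.digitEquiv.symm x) = x := S.digitEquiv.apply_symm_apply x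
  rwa [h2] at h

theorem digit_add (x y : G) (n : ℤ) : S.digit (x + y) n = S.digit x n + S.digit y n := by
  simp [digit]

theorem mem_sub_iff (x : G) (m : ℤ) : x ∈ S.sub m ↔ ∀ n < m, S.digit x n = 0 := by
  have h := S.ofDigits_mem_iff (S.digitEquiv.symm x) m
  have h2 : S.ofDigits (S.digitEquiv.symm x) = x := S.digitEquiv.apply_symm_apply x
  rwa [h2] at h

/-- The dilation operator `𝒜 (∑ a_n g_n) = ∑ a_n g_{n-1}`. -/
noncomputable def dilation : G ≃+ G :=
  (S.digitEquiv.symm.trans (digitShift p)).trans S.digitEquiv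

theorem digit_dilation (x : G) (n : ℤ) : S.digit (S.dilation x) n = S.digit x (n + 1) := by
  simp [digit, dilation, digitShift]

theorem digit_dilation_symm (x : G) (n : ℤ) :
    S.digit (S.dilation.symm x) n = S.digit x (n - 1) := by
  simp [digit, dilation, digitShift]

theorem hasSum_dilation (x : G) :
    HasSum (fun n => (S.digit x n).val • S.g (n - 1)) (S.dilation x) := by
  have h := S.hasSum_digit (S.dilation x)
  simp only [digit_dilation] at h
  rw [← (Equiv.subRight (1 : ℤ)).hasSum_iff] at h
  simpa [Function.comp_def] using h

theorem continuous_dilation : Continuous S.dilation := by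
  refine continuous_of_continuousAt_zero S.dilation ?_
  rw [ContinuousAt, map_zero]
  intro U hU
  rw [mem_map]
  obtain ⟨n, hn⟩ := S.exists_sub_subset U hU
  filter_upwards [(S.isOpen_sub (n + 1)).mem_nhds (zero_mem _)] with x hx
  refine hn ((S.mem_sub_iff _ n).2 fun k hk => ?_)
  rw [digit_dilation]
  exact (S.mem_sub_iff _ _).1 hx _ (by omega)

theorem continuous_dilation_symm : Continuous S.dilation.symm := by
  refine continuous_of_continuousAt_zero S.dilation.symm ?_
  rw [ContinuousAt, map_zero]
  intro U hU
  rw [mem_map]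
  obtain ⟨n, hn⟩ := S.exists_sub_subset U hU
  filter_upwards [(S.isOpen_sub (n - 1)).mem_nhds (zero_mem _)] with x hx
  refine hn ((S.mem_sub_iff _ n).2 fun k hk => ?_)
  rw [digit_dilation_symm]
  exact (S.mem_sub_iff _ _).1 hx _ (by omega)

end expansions

end BasicSystem

/-- The group `X` of (continuous, unitary) characters of the additively written group `G`. -/
abbrev CharGroup (G : Type*) [AddCommGroup G] [TopologicalSpace G] : Type _ :=
  PontryaginDual (Multiplicative G)

/-- The value `(χ, x)` of a character. -/
noncomputable def pairing {G : Type*} [AddCommGroup G] [TopologicalSpace G]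
    (χ : CharGroup G) (x : G) : ℂ :=
  (χ (Multiplicative.ofAdd x) : Circle)

namespace BasicSystem

section characters

variable {p : ℕ} {G : Type*} [AddCommGroup G] [TopologicalSpace G] (S : BasicSystem p G)

/-- The annihilator `G_n^⊥`. -/
def ann (n : ℤ) : Subgroup (CharGroup G) where
  carrier := {χ | ∀ x ∈ S.sub n, pairing χ x = 1}
  one_mem' := fun x _ => by simp [pairing]
  mul_mem' := by
    intro χ ψ hχ hψ x hx
    have h1 := hχ x hx
    have h2 := hψ x hx
    simp only [pairing, Circle.coe_eq_one] at h1 h2 ⊢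
    change χ (Multiplicative.ofAdd x) * ψ (Multiplicative.ofAdd x) = 1
    rw [h1, h2, one_mul]
  inv_mem' := by
    intro χ hχ x hx
    have h1 := hχ x hx
    simp only [pairing, Circle.coe_eq_one] at h1 ⊢
    change (χ (Multiplicative.ofAdd x))⁻¹ = 1
    rw [h1, inv_one]

/-- The coset `G_n^⊥ ζ`. -/
def coset (n : ℤ) (ζ : CharGroup G) : Set (CharGroup G) :=
  (fun θ => θ * ζ) '' (S.ann n : Set (CharGroup G))

/-- The class `𝔇_{-N}(G_M^⊥)` of step functions on `X` that are supported in `G_M^⊥` and constant on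
the cosets of `G_{-N}^⊥`.  Such a function takes finitely many values, each nonzero one on a finite
union of cosets of the compact group `G_{-N}^⊥`, so that square integrability is automatic. -/
def StepClass (N M : ℕ) : Set (CharGroup G → ℂ) :=
  {f | (∀ χ, χ ∉ S.ann M → f χ = 0) ∧
    ∀ χ, ∀ θ ∈ S.ann (-(N : ℤ)), f (θ * χ) = f χ}

/-- The element `a_{-1} g_{-1} + ⋯ + a_{-s} g_{-s}` of `H_0^{(s)}`. -/
def shiftElt {s : ℕ} (a : Fin s → Fin p) : G :=
  ∑ i : Fin s, (a i : ℕ) • S.g (-((i : ℤ) + 1))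

variable [Fact p.Prime] [IsTopologicalAddGroup G] [LocallyCompactSpace G]

/-- The Rademacher character `(r_n, ∑ a_k g_k) = exp (2πi a_n / p)`. -/
noncomputable def rademacher (n : ℤ) : CharGroup G where
  toFun x := ZMod.toCircle (S.digit x.toAdd n)
  map_one' := by simp [digit]
  map_mul' x y := by simp [digit_add, AddChar.map_add_eq_mul]
  continuous_toFun := by
    let f : Multiplicative G →* Circle :=
      { toFun := fun x => ZMod.toCircle (S.digit x.toAdd n)
        map_one' := by simp [digit]
        map_mul' := fun x y => by simp [digit_add, AddChar.map_add_eq_mul] }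
    refine continuous_of_continuousAt_one f ?_
    rw [ContinuousAt, map_one]
    intro U hU
    have h1 : {x : Multiplicative G | x.toAdd ∈ S.sub (n + 1)} ∈ 𝓝 (1 : Multiplicative G) :=
      (S.isOpen_sub (n + 1)).mem_nhds (zero_mem _)
    rw [mem_map]
    filter_upwards [h1] with x hx
    have h2 : f x = 1 := by
      change ZMod.toCircle (S.digit x.toAdd n) = 1
      rw [(S.mem_sub_iff _ _).1 hx n (by omega), AddChar.map_zero_eq_one]
    rw [Set.mem_preimage, h2]
    exact mem_of_mem_nhds hU

theorem pairing_rademacher (n : ℤ) (x : G) :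
    pairing (S.rademacher n) x =
      Complex.exp (2 * Real.pi * Complex.I * ((S.digit x n).val : ℂ) / p) :=
  ZMod.toCircle_apply _

/-- The map `χ ↦ χ𝒜`, `(χ𝒜, x) = (χ, 𝒜x)`, on characters; its inverse is `χ ↦ χ𝒜⁻¹`. -/
noncomputable def charDilation : CharGroup G ≃ CharGroup G where
  toFun := PontryaginDual.map
    ⟨AddMonoidHom.toMultiplicative S.dilation.toAddMonoidHom, S.continuous_dilation⟩
  invFun := PontryaginDual.map
    ⟨AddMonoidHom.toMultiplicative S.dilation.symm.toAddMonoidHom, S.continuous_dilation_symm⟩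
  left_inv χ := by
    ext x
    change ((χ (Multiplicative.ofAdd (S.dilation (S.dilation.symm x.toAdd))) : Circle) : ℂ) = χ x
    rw [AddEquiv.apply_symm_apply, ofAdd_toAdd]
  right_inv χ := by
    ext x
    change ((χ (Multiplicative.ofAdd (S.dilation.symm (S.dilation x.toAdd))) : Circle) : ℂ) = χ x
    rw [AddEquiv.symm_apply_apply, ofAdd_toAdd]

theorem pairing_charDilation (χ : CharGroup G) (x : G) :
    pairing (S.charDilation χ) x = pairing χ (S.dilation x) := rfl

/-- `φ̂` solves the refinement equation `φ̂(χ) = m₀(χ) φ̂(χ𝒜⁻¹)`. -/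
def SolvesRefinement (m₀ φhat : CharGroup G → ℂ) : Prop :=
  ∀ χ, φhat χ = m₀ χ * φhat (S.charDilation.symm χ)

/-- `m₀` has the form of a mask, `m₀(χ) = p⁻¹ ∑_{h ∈ H_0^{(N+1)}} β_h conj (χ𝒜⁻¹, h)`.  The elements
`h` are enumerated by their digits. -/
def IsMask (N : ℕ) (m₀ : CharGroup G → ℂ) : Prop :=
  ∃ β : G → ℂ, ∀ χ, m₀ χ = (1 / (p : ℂ)) * ∑ a : Fin (N + 1) → Fin p,
    β (S.shiftElt a) * (starRingEnd ℂ) (pairing (S.charDilation.symm χ) (S.shiftElt a))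

/-- `m₀` is an `N`-elementary mask. -/
structure IsElementaryMask (N : ℕ) (m₀ : CharGroup G → ℂ) : Prop where
  isMask : S.IsMask N m₀
  const_on_cosets : ∀ χ, ∀ θ ∈ S.ann (-(N : ℤ)), m₀ (θ * χ) = m₀ χ
  abs_eq_zero_or_one : ∀ χ, ‖m₀ χ‖ = 0 ∨ ‖m₀ χ‖ = 1
  eq_one : ∀ θ ∈ S.ann (-(N : ℤ)), m₀ θ = 1

/-- The character `ξ_a = r_{-N}^{a_0} r_{-N+1}^{a_1} ⋯ r_{-1}^{a_{N-1}}`. -/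
noncomputable def xi {N : ℕ} (a : Fin N → Fin p) : CharGroup G :=
  ∏ i : Fin N, S.rademacher (-(N : ℤ) + (i : ℤ)) ^ (a i : ℕ)

/-- The character `η_b = r_0^{b_0} r_1^{b_1} ⋯ r_{M-1}^{b_{M-1}}`. -/
noncomputable def eta {M : ℕ} (b : Fin M → Fin p) : CharGroup G :=
  ∏ i : Fin M, S.rademacher (i : ℤ) ^ (b i : ℕ)

/-- `(N,M)`-elementary sets: `E` is the disjoint union of the `p ^ N` cosets `G_{-N}^⊥ ξ_j η_j`.  The
index `j = 0, …, p ^ N - 1` is represented by its base-`p` digits `a`. -/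
def IsElementarySet (N M : ℕ) (E : Set (CharGroup G)) : Prop :=
  ∃ b : (Fin N → Fin p) → (Fin M → Fin p),
    E = ⋃ a, S.coset (-(N : ℤ)) (S.xi a * S.eta (b a)) ∧
    Pairwise (fun a a' => Disjoint (S.coset (-(N : ℤ)) (S.xi a * S.eta (b a)))
      (S.coset (-(N : ℤ)) (S.xi a' * S.eta (b a')))) ∧
    (⋃ a : Fin N → Fin p, S.coset (-(N : ℤ)) (S.xi a)) = S.ann 0 ∧
    Pairwise (fun a a' : Fin N → Fin p =>
      Disjoint (S.coset (-(N : ℤ)) (S.xi a)) (S.coset (-(N : ℤ)) (S.xi a'))) ∧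
    S.coset (-(N : ℤ)) (S.xi (fun _ : Fin N => (0 : Fin p))) = S.ann (-(N : ℤ)) ∧
    ∀ l : ℕ, l < M + N →
      ((S.ann (-(N : ℤ) + l + 1) \ S.ann (-(N : ℤ) + l) : Set (CharGroup G)) ∩ E).Nonempty

/-- The periodic extension
`Ẽ_X = ⋃_{s ≥ 1} ⋃_{α_1, …, α_s} Ẽ r_1^{α_1} ⋯ r_s^{α_s}`. -/
def periodicExtension (E' : Set (CharGroup G)) : Set (CharGroup G) :=
  ⋃ s : ℕ, ⋃ _ : 1 ≤ s, ⋃ α : Fin s → Fin p,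
    (fun χ => χ * ∏ i : Fin s, S.rademacher ((i : ℤ) + 1) ^ (α i : ℕ)) '' E'

/-- The set `Ẽ` of a tree `T` on `{0, …, p-1}` rooted at `0`: the union of `G_{-1}^⊥` and of all
cosets `G_{-1}^⊥ r_{-1}^i r_0^j` for which `(j, i)` is a pair of consecutive vertices (in this order)
of a path of `T` that starts at the root. -/
def treeSet (T : SimpleGraph (Fin p)) : Set (CharGroup G) :=
  {χ | ∃ (v : Fin p) (P : T.Walk 0 v), P.IsPath ∧ ∃ d ∈ P.darts,
    χ ∈ S.coset (-1) (S.rademacher (-1) ^ (d.snd : ℕ) * S.rademacher 0 ^ (d.fst : ℕ))} ∪ S.ann (-1)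

/-- The tree `T`, rooted at `0`, generates `E`, that is, `E = ⋂_{n ≥ 0} Ẽ_X 𝒜ⁿ`. -/
def TreeGenerates (T : SimpleGraph (Fin p)) (E : Set (CharGroup G)) : Prop :=
  E = ⋂ n : ℕ, (S.charDilation)^[n] '' S.periodicExtension (S.treeSet T)

end characters

end BasicSystem

/-- The tree `T`, rooted at `0`, has height `H`: the largest number of vertices of a path that
starts at the root is `H` (a one-vertex tree has height `1`). -/
def HasHeight {p : ℕ} [NeZero p] (T : SimpleGraph (Fin p)) (H : ℕ) : Prop :=
  IsGreatest {k | ∃ (v : Fin p) (P : T.Walk 0 v), P.IsPath ∧ P.support.length = k} H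

/-! Write a character as `χ = ∏ r_k ^ a_k`, its digits `a_k ∈ {0, …, p - 1}` being read off from the
values `(χ, g_k)`.  A coset of `G_{-1}^⊥` is the word `a_{-1} a_0 a_1 …` of the digits from index
`-1` on (`BasicSystem.mem_coset_iff`), and `χ ↦ χ𝒜⁻¹` deletes the first letter of the word.  A
`(1, M)`-elementary set is a set of words with exactly one word for each first letter
(`BasicSystem.IsElementarySet.exists_representatives`).

Since `|φ̂| = 1_E`, the refinement equation shows that `E` is closed under deletion of the first
letter.  Hence the second letter of the word starting with `i` is a function `f i` of `i`, and the
whole word is `i, f i, f (f i), …`; as all words end in zeros, `f 0 = 0` and every letter is mapped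
to `0` by an iterate of `f` (`BasicSystem.IsElementarySet.exists_parent`).  So `f` is the parent map
of a tree `T` rooted at `0` (`parentGraph.isTree`).  The level condition with `l = M` provides
a letter `i` with `f^[M] i ≠ 0`, whereas `f^[M + 1] = 0`, and so the height is `M + 2`
(`parentGraph.hasHeight`).

A path of `T` from the root runs from parents to children, so `Ẽ_X` consists of characters with
`a_0 = f a_{-1}`, and `Ẽ_X 𝒜ⁿ` of characters with `a_n = f a_{n-1}`.  The intersection over `n ≥ 0`
is the set of words that follow `f`, which is `E` (`BasicSystem.treeGenerates_parentGraph`). -/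

/-! ### Trees given by a parent map -/

/-- The graph on `V` in which every vertex `v` with `f v ≠ v` is joined to its parent `f v`. -/
def parentGraph {V : Type*} (f : V → V) : SimpleGraph V where
  Adj u v := u ≠ v ∧ (f u = v ∨ f v = u)
  symm := ⟨fun _ _ h => ⟨h.1.symm, h.2.symm⟩⟩
  loopless := ⟨fun _ h => h.1 rfl⟩

namespace parentGraph

variable {V : Type*} {f : V → V} {r : V}

/-- A path that does not begin with the step from `u` to its parent moves from parent to child
throughout: each vertex is entered from its parent, so the path can only leave it towards a
child. -/
theorem apply_snd_of_mem_darts {u v : V} (P : (parentGraph f).Walk u v) (hP : P.IsPath)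
    (hu : f u ∉ P.support.tail) : ∀ d ∈ P.darts, f d.snd = d.fst := by
  induction P with
  | nil => simp
  | cons h q ih =>
    rename_i a b c
    rw [SimpleGraph.Walk.cons_isPath_iff] at hP
    rw [SimpleGraph.Walk.support_cons, List.tail_cons] at hu
    have hb : f b = a := by
      rcases h.2 with h1 | h1
      · exact absurd (h1 ▸ q.start_mem_support) hu
      · exact h1
    intro d hd
    rw [SimpleGraph.Walk.darts_cons, List.mem_cons] at hd
    rcases hd with rfl | hd
    · exact hb
    · exact ih hP.1 (fun h2 => hP.2 (hb ▸ List.mem_of_mem_tail h2)) d hd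

theorem apply_snd_of_isPath (hr : f r = r) {v : V} (P : (parentGraph f).Walk r v)
    (hP : P.IsPath) : ∀ d ∈ P.darts, f d.snd = d.fst := by
  refine apply_snd_of_mem_darts P hP ?_
  rw [hr]
  have h := hP.support_nodup
  rw [← SimpleGraph.Walk.cons_tail_support, List.nodup_cons] at h
  exact h.1

theorem iterate_length_of_darts {u v : V} (P : (parentGraph f).Walk u v)
    (h : ∀ d ∈ P.darts, f d.snd = d.fst) : f^[P.length] v = u := by
  induction P with
  | nil => rfl
  | cons h1 q ih =>
    rw [SimpleGraph.Walk.length_cons, Function.iterate_succ_apply',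
      ih fun d hd => h d (by simp [hd])]
    exact h _ (by rw [SimpleGraph.Walk.darts_cons]; exact List.mem_cons_self)

/-- A path descending from `u` to `v` passes, after its start, through all ancestors `f^[k] v` with
`k` less than its length. -/
theorem iterate_mem_support_tail {u v : V} (P : (parentGraph f).Walk u v)
    (h : ∀ d ∈ P.darts, f d.snd = d.fst) {k : ℕ} (hk : k < P.length) :
    f^[k] v ∈ P.support.tail := by
  induction P with
  | nil => simp at hk
  | cons h1 q ih =>
    have hq : ∀ d ∈ q.darts, f d.snd = d.fst := fun d hd => h d (by simp [hd])
    rw [SimpleGraph.Walk.support_cons, List.tail_cons]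
    rw [SimpleGraph.Walk.length_cons, Nat.lt_succ_iff] at hk
    rcases hk.lt_or_eq with hk | rfl
    · exact List.mem_of_mem_tail (ih hq hk)
    · rw [iterate_length_of_darts q hq]
      exact q.start_mem_support

theorem iterate_length (hr : f r = r) {v : V} (P : (parentGraph f).Walk r v) (hP : P.IsPath) :
    f^[P.length] v = r :=
  iterate_length_of_darts P (apply_snd_of_isPath hr P hP)

theorem iterate_ne_of_lt_length (hr : f r = r) {v : V} (P : (parentGraph f).Walk r v)
    (hP : P.IsPath) {k : ℕ} (hk : k < P.length) : f^[k] v ≠ r := by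
  intro h
  have h1 := iterate_mem_support_tail P (apply_snd_of_isPath hr P hP) hk
  have h2 := hP.support_nodup
  rw [← SimpleGraph.Walk.cons_tail_support, List.nodup_cons] at h2
  exact h2.1 (h ▸ h1)

theorem reachable_iterate (f : V → V) (v : V) (k : ℕ) :
    (parentGraph f).Reachable v (f^[k] v) := by
  induction k with
  | zero => exact SimpleGraph.Reachable.refl _
  | succ k ih =>
    rw [Function.iterate_succ_apply']
    by_cases h : f^[k] v = f (f^[k] v)
    · rwa [← h]
    · exact ih.trans (SimpleGraph.Adj.reachable ⟨h, Or.inl rfl⟩)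

theorem connected (hf : ∀ v, ∃ k, f^[k] v = r) : (parentGraph f).Connected := by
  rw [SimpleGraph.connected_iff_exists_forall_reachable]
  refine ⟨r, fun v => ?_⟩
  obtain ⟨k, hk⟩ := hf v
  exact (hk ▸ reachable_iterate f v k).symm

theorem eq_root_of_apply_eq_self (hf : ∀ v, ∃ k, f^[k] v = r) {v : V} (h : f v = v) : v = r := by
  obtain ⟨k, hk⟩ := hf v
  rwa [Function.iterate_fixed h] at hk

/-- If every vertex has the fixed point `r` as an ancestor, the parent graph is a tree: it is
connected, and its edges `{v, f v}` correspond to the vertices `v ≠ r`. -/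
theorem isTree [Finite V] (hr : f r = r) (hf : ∀ v, ∃ k, f^[k] v = r) :
    (parentGraph f).IsTree := by
  rw [SimpleGraph.isTree_iff_connected_and_card]
  refine ⟨connected hf, ?_⟩
  have himg : (parentGraph f).edgeSet = (fun v => s(v, f v)) '' {r}ᶜ := by
    ext e
    induction e with
    | _ a b =>
      rw [SimpleGraph.mem_edgeSet]
      constructor
      · rintro ⟨hne, h | h⟩
        · exact ⟨a, fun ha => hne (by rw [Set.mem_singleton_iff] at ha; rw [← h, ha, hr]),
            by simp [h]⟩
        · exact ⟨b, fun hb => hne (by rw [Set.mem_singleton_iff] at hb; rw [← h, hb, hr]),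
            by simp [h, Sym2.eq_swap]⟩
      · rintro ⟨v, hv, h⟩
        have hv2 : v ≠ f v := fun h2 => hv (eq_root_of_apply_eq_self hf h2.symm)
        rw [← SimpleGraph.mem_edgeSet, ← h]
        exact ⟨hv2, Or.inl rfl⟩
  have hinj : Set.InjOn (fun v => s(v, f v)) ({r}ᶜ : Set V) := by
    intro v hv w _ h
    rcases Sym2.eq_iff.1 h with h1 | ⟨h1, h2⟩
    · exact h1.1
    · -- The edge would join `v` and `w` as parents of each other, a 2-cycle of `f` off the root.
      exfalso
      apply hv
      obtain ⟨k, hk⟩ := hf v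
      have h3 : f^[2] v = v := by
        change f (f v) = v
        rw [h2, ← h1]
      have h4 : (f^[2])^[k] v = v := Function.iterate_fixed h3 k
      rw [← Function.iterate_mul, Nat.mul_comm 2 k, Nat.mul_two, Function.iterate_add_apply,
        hk, Function.iterate_fixed hr] at h4
      exact h4.symm
  rw [Nat.card_coe_set_eq, himg, hinj.ncard_image, ← Set.ncard_singleton r, add_comm,
    Set.ncard_add_ncard_compl]

theorem exists_isPath (hf : ∀ v, ∃ k, f^[k] v = r) (v : V) :
    ∃ P : (parentGraph f).Walk r v, P.IsPath := by
  obtain ⟨P⟩ := (connected hf).preconnected r v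
  classical
  exact ⟨P.bypass, P.bypass_isPath⟩

theorem exists_dart_iff (hr : f r = r) (hf : ∀ v, ∃ k, f^[k] v = r) (i j : V) :
    (∃ (v : V) (P : (parentGraph f).Walk r v), P.IsPath ∧ ∃ d ∈ P.darts, d.snd = i ∧ d.fst = j) ↔
      i ≠ r ∧ f i = j := by
  constructor
  · rintro ⟨v, P, hP, d, hd, rfl, rfl⟩
    have h := apply_snd_of_isPath hr P hP d hd
    refine ⟨fun h2 => d.adj.1 ?_, h⟩
    rw [← h, h2, hr]
  · rintro ⟨hi, rfl⟩
    obtain ⟨P, hP⟩ := exists_isPath hf i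
    have h1 : i ∈ P.support.tail := by
      have h2 := P.end_mem_support
      rw [← SimpleGraph.Walk.cons_tail_support, List.mem_cons] at h2
      exact h2.resolve_left hi
    rw [← SimpleGraph.Walk.map_snd_darts, List.mem_map] at h1
    obtain ⟨d, hd, hdi⟩ := h1
    exact ⟨i, P, hP, d, hd, hdi, by rw [← apply_snd_of_isPath hr P hP d hd, hdi]⟩

theorem hasHeight {p : ℕ} [NeZero p] {f : Fin p → Fin p} (hr : f 0 = 0) {H : ℕ}
    (hH : ∀ v, f^[H + 1] v = 0) {w : Fin p} (hw : f^[H] w ≠ 0) :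
    HasHeight (parentGraph f) (H + 2) := by
  have hle {v : Fin p} (P : (parentGraph f).Walk 0 v) (hP : P.IsPath) : P.length ≤ H + 1 := by
    by_contra h
    exact iterate_ne_of_lt_length hr P hP (not_le.1 h) (hH v)
  constructor
  · obtain ⟨P, hP⟩ := exists_isPath (fun v => ⟨H + 1, hH v⟩) w
    refine ⟨w, P, hP, ?_⟩
    have h1 : H < P.length := by
      by_contra h
      apply hw
      rw [← Nat.sub_add_cancel (not_lt.1 h), Function.iterate_add_apply, iterate_length hr P hP,
        Function.iterate_fixed hr]
    rw [SimpleGraph.Walk.length_support]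
    have h2 := hle P hP
    omega
  · rintro k ⟨v, P, hP, rfl⟩
    rw [SimpleGraph.Walk.length_support]
    have := hle P hP
    omega

end parentGraph

/-! ### Digits of characters -/

namespace BasicSystem

variable {p : ℕ} [Fact p.Prime] {G : Type*} [AddCommGroup G] [TopologicalSpace G]

theorem exists_toCircle_eq (S : BasicSystem p G) (χ : CharGroup G) (n : ℤ) :
    ∃ a : ZMod p, ZMod.toCircle a = χ (Multiplicative.ofAdd (S.g n)) := by
  have hp : p ≠ 0 := (Fact.out : p.Prime).ne_zero
  have h1 : χ (Multiplicative.ofAdd (S.g n)) ^ p = 1 := by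
    rw [← map_pow, ← ofAdd_nsmul, S.nsmul_g, ofAdd_zero, map_one]
  have h2 : ((χ (Multiplicative.ofAdd (S.g n)) : Circle) : ℂ) ^ p = 1 := by
    rw [← Circle.coe_pow, h1, Circle.coe_one]
  obtain ⟨i, -, hi⟩ := (Complex.isPrimitiveRoot_exp p hp).eq_pow_of_pow_eq_one h2
  refine ⟨((i : ℤ) : ZMod p), Circle.ext ?_⟩
  rw [ZMod.toCircle_intCast, ← hi, ← Complex.exp_nat_mul]
  congr 1
  push_cast
  ring

/-- The digit `a_n` of a character `χ = ∏ r_k ^ a_k`, that is, the residue `a_n` with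
`(χ, g_n) = exp (2πi a_n / p)`. -/
noncomputable def charDigit (S : BasicSystem p G) (χ : CharGroup G) (n : ℤ) : ZMod p :=
  (S.exists_toCircle_eq χ n).choose

variable (S : BasicSystem p G)

theorem toCircle_charDigit (χ : CharGroup G) (n : ℤ) :
    ZMod.toCircle (S.charDigit χ n) = χ (Multiplicative.ofAdd (S.g n)) :=
  (S.exists_toCircle_eq χ n).choose_spec

theorem charDigit_eq_iff (χ : CharGroup G) (n : ℤ) (a : ZMod p) :
    S.charDigit χ n = a ↔ χ (Multiplicative.ofAdd (S.g n)) = ZMod.toCircle a := by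
  rw [← toCircle_charDigit, ZMod.injective_toCircle.eq_iff]

theorem charDigit_mul (χ ψ : CharGroup G) (n : ℤ) :
    S.charDigit (χ * ψ) n = S.charDigit χ n + S.charDigit ψ n := by
  rw [charDigit_eq_iff, AddChar.map_add_eq_mul, toCircle_charDigit, toCircle_charDigit]
  rfl

/-- The `n`-th digit as a homomorphism. -/
noncomputable def charDigitHom (n : ℤ) : CharGroup G →* Multiplicative (ZMod p) :=
  MonoidHom.mk' (fun χ => Multiplicative.ofAdd (S.charDigit χ n)) fun χ ψ => by
    rw [charDigit_mul, ofAdd_add]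

theorem charDigit_one (n : ℤ) : S.charDigit 1 n = 0 :=
  congrArg Multiplicative.toAdd (map_one (S.charDigitHom n))

theorem charDigit_inv (χ : CharGroup G) (n : ℤ) : S.charDigit χ⁻¹ n = -S.charDigit χ n :=
  congrArg Multiplicative.toAdd (map_inv (S.charDigitHom n) χ)

theorem charDigit_pow (χ : CharGroup G) (k : ℕ) (n : ℤ) :
    S.charDigit (χ ^ k) n = k * S.charDigit χ n := by
  rw [← nsmul_eq_mul]
  exact congrArg Multiplicative.toAdd (map_pow (S.charDigitHom n) χ k)

theorem charDigit_prod {ι : Type*} (s : Finset ι) (χ : ι → CharGroup G) (n : ℤ) :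
    S.charDigit (∏ i ∈ s, χ i) n = ∑ i ∈ s, S.charDigit (χ i) n := by
  have h := congrArg Multiplicative.toAdd (map_prod (S.charDigitHom n) χ s)
  rw [toAdd_prod] at h
  exact h

/-- The `n`-th digit of a character as an element of `{0, …, p - 1}`, the vertex set of the
trees. -/
noncomputable def charLetter (χ : CharGroup G) (n : ℤ) : Fin p :=
  ⟨(S.charDigit χ n).val, ZMod.val_lt _⟩

theorem charLetter_eq_iff (χ : CharGroup G) (n : ℤ) (i : Fin p) :
    S.charLetter χ n = i ↔ S.charDigit χ n = ((i : ℕ) : ZMod p) := by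
  rw [charLetter, Fin.ext_iff]
  constructor
  · intro h
    rw [← h, ZMod.natCast_zmod_val]
  · intro h
    change (S.charDigit χ n).val = i
    rw [h, ZMod.val_natCast, Nat.mod_eq_of_lt i.2]

theorem charLetter_eq_charLetter_iff (χ ψ : CharGroup G) (m n : ℤ) :
    S.charLetter χ m = S.charLetter ψ n ↔ S.charDigit χ m = S.charDigit ψ n := by
  rw [charLetter_eq_iff, charLetter, ZMod.natCast_zmod_val]

theorem charLetter_eq_zero_iff (χ : CharGroup G) (n : ℤ) :
    S.charLetter χ n = 0 ↔ S.charDigit χ n = 0 := by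
  rw [charLetter_eq_iff, Fin.val_zero, Nat.cast_zero]

theorem natCast_charLetter (χ : CharGroup G) (n : ℤ) :
    ((S.charLetter χ n : ℕ) : ZMod p) = S.charDigit χ n :=
  ((S.charLetter_eq_iff χ n _).1 rfl).symm

variable [IsTopologicalAddGroup G] [LocallyCompactSpace G]

theorem digit_g (m n : ℤ) : S.digit (S.g m) n = if n = m then 1 else 0 := by
  have h1 : (1 : ZMod p).val = 1 := ZMod.val_one p
  let a : digitSpace p := ⟨Pi.single m 1, m, fun n hn => Pi.single_eq_of_ne hn.ne _⟩
  have h2 : S.ofDigits a = S.g m := by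
    have _ := S.t2
    refine (S.hasSum_ofDigits a).unique ?_
    have h3 := hasSum_single (f := fun n => (a.1 n).val • S.g n) m fun n hn => by
      simp [a, Pi.single_eq_of_ne hn]
    simpa [a, h1] using h3
  have h3 : S.digitEquiv.symm (S.g m) = a := by
    rw [AddEquiv.symm_apply_eq]
    exact h2.symm
  rw [digit, h3]
  exact Pi.single_apply m (1 : ZMod p) n

theorem charDigit_rademacher (m n : ℤ) :
    S.charDigit (S.rademacher m) n = if n = m then 1 else 0 := by
  rw [charDigit_eq_iff]
  change ZMod.toCircle (S.digit (S.g n) m) = _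
  rw [digit_g]
  simp only [eq_comm]

theorem dilation_g (n : ℤ) : S.dilation (S.g n) = S.g (n - 1) := by
  have _ := S.t2
  refine (S.hasSum_dilation (S.g n)).unique ?_
  have h := hasSum_single (f := fun k => (S.digit (S.g n) k).val • S.g (k - 1)) n fun k hk => by
    simp [digit_g, hk]
  simpa [digit_g, ZMod.val_one p] using h

theorem charDigit_charDilation (χ : CharGroup G) (n : ℤ) :
    S.charDigit (S.charDilation χ) n = S.charDigit χ (n - 1) := by
  rw [charDigit_eq_iff, toCircle_charDigit, ← dilation_g]
  rfl

theorem charDigit_charDilation_symm (χ : CharGroup G) (n : ℤ) :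
    S.charDigit (S.charDilation.symm χ) n = S.charDigit χ (n + 1) := by
  have h := S.charDigit_charDilation (S.charDilation.symm χ) (n + 1)
  rw [Equiv.apply_symm_apply, add_sub_cancel_right] at h
  exact h.symm

theorem charDigit_iterate_symm (χ : CharGroup G) (k : ℕ) (n : ℤ) :
    S.charDigit (S.charDilation.symm^[k] χ) n = S.charDigit χ (n + k) := by
  induction k generalizing n with
  | zero => simp
  | succ k ih =>
    rw [Function.iterate_succ_apply', charDigit_charDilation_symm, ih]
    congr 1
    push_cast
    ring

/-- A character annihilates `G_m` exactly when its digits from `m` on vanish: `G_m` is the closed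
span of the `g_n` with `n ≥ m`. -/
theorem mem_ann_iff (χ : CharGroup G) (m : ℤ) : χ ∈ S.ann m ↔ ∀ n ≥ m, S.charDigit χ n = 0 := by
  constructor
  · intro h n hn
    rw [charDigit_eq_iff, AddChar.map_zero_eq_one]
    exact Circle.coe_eq_one.1 (h _ (S.sub_anti hn (S.g_mem n)))
  · intro h x hx
    have h1 : ∀ n, χ (Multiplicative.ofAdd ((S.digit x n).val • S.g n)) = 1 := by
      intro n
      by_cases hn : n < m
      · rw [(S.mem_sub_iff x m).1 hx n hn, ZMod.val_zero, zero_smul, ofAdd_zero, map_one]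
      · rw [ofAdd_nsmul, map_pow, ← toCircle_charDigit, h n (not_lt.1 hn),
          AddChar.map_zero_eq_one, one_pow]
    have hc : Continuous fun y : G => χ (Multiplicative.ofAdd y) :=
      (map_continuous χ).comp continuous_ofAdd
    have h2 := (hc.tendsto x).comp (S.hasSum_digit x)
    have h3 : ((fun y : G => χ (Multiplicative.ofAdd y)) ∘ fun s : Finset ℤ =>
        ∑ n ∈ s, (S.digit x n).val • S.g n) = fun _ => 1 := by
      funext s
      simp only [Function.comp_apply, ofAdd_sum, map_prod, h1, Finset.prod_const_one]
    rw [h3] at h2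
    exact Circle.coe_eq_one.2 (tendsto_nhds_unique h2 tendsto_const_nhds)

theorem mem_coset_iff (m : ℤ) (ζ χ : CharGroup G) :
    χ ∈ S.coset m ζ ↔ ∀ n ≥ m, S.charDigit χ n = S.charDigit ζ n := by
  have h : χ ∈ S.coset m ζ ↔ χ * ζ⁻¹ ∈ S.ann m := by
    constructor
    · rintro ⟨θ, hθ, rfl⟩
      simpa using hθ
    · intro h
      exact ⟨_, h, inv_mul_cancel_right _ _⟩
  simp only [h, mem_ann_iff, charDigit_mul, charDigit_inv, ← sub_eq_add_neg, sub_eq_zero]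

/-! ### The set generated by a parent map -/

theorem mem_treeSet_parentGraph {f : Fin p → Fin p} (hr : f 0 = 0) (hf : ∀ v, ∃ k, f^[k] v = 0)
    (χ : CharGroup G) : χ ∈ S.treeSet (parentGraph f) ↔
      S.charLetter χ 0 = f (S.charLetter χ (-1)) ∧ ∀ n ≥ 1, S.charDigit χ n = 0 := by
  have key (i j : Fin p) : χ ∈ S.coset (-1) (S.rademacher (-1) ^ (i : ℕ) * S.rademacher 0 ^ (j : ℕ))
      ↔ S.charLetter χ (-1) = i ∧ S.charLetter χ 0 = j ∧ ∀ n ≥ 1, S.charDigit χ n = 0 := by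
    simp only [mem_coset_iff, charDigit_mul, charDigit_pow, charDigit_rademacher,
      charLetter_eq_iff]
    constructor
    · intro h
      refine ⟨by simpa using h (-1) le_rfl, by simpa using h 0 (by omega), fun n hn => ?_⟩
      have h1 : n ≠ -1 := by omega
      have h2 : n ≠ 0 := by omega
      simpa [h1, h2] using h n (by omega)
    · rintro ⟨h1, h2, h3⟩ n hn
      rcases (show n = -1 ∨ n = 0 ∨ 1 ≤ n by omega) with rfl | rfl | h4
      · simpa using h1
      · simpa using h2
      · have h5 : n ≠ -1 := by omega
        have h6 : n ≠ 0 := by omega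
        simpa [h5, h6] using h3 n h4
  have hann : χ ∈ S.ann (-1) ↔
      S.charLetter χ (-1) = 0 ∧ S.charLetter χ 0 = 0 ∧ ∀ n ≥ 1, S.charDigit χ n = 0 := by
    rw [← key, mem_ann_iff, mem_coset_iff]
    simp [charDigit_one]
  rw [treeSet, Set.mem_union, Set.mem_ofPred_eq, SetLike.mem_coe, hann]
  constructor
  · rintro (⟨v, P, hP, d, hd, h⟩ | ⟨h1, h2, h3⟩)
    · rw [key] at h
      have h2 := (parentGraph.exists_dart_iff hr hf d.snd d.fst).1 ⟨v, P, hP, d, hd, rfl, rfl⟩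
      exact ⟨by rw [h.1, h.2.1, h2.2], h.2.2⟩
    · exact ⟨by rw [h1, h2, hr], h3⟩
  · rintro ⟨h1, h2⟩
    by_cases h0 : S.charLetter χ (-1) = 0
    · exact Or.inr ⟨h0, by rw [h1, h0, hr], h2⟩
    · obtain ⟨v, P, hP, d, hd, h3, h4⟩ := (parentGraph.exists_dart_iff hr hf
        (S.charLetter χ (-1)) (S.charLetter χ 0)).2 ⟨h0, h1.symm⟩
      exact Or.inl ⟨v, P, hP, d, hd, (key _ _).2 ⟨h3.symm, h4.symm, h2⟩⟩

theorem charDigit_prod_rademacher {s : ℕ} (m : ℤ) (α : Fin s → Fin p) (n : ℤ) :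
    S.charDigit (∏ i : Fin s, S.rademacher (m + (i : ℤ)) ^ (α i : ℕ)) n =
      ∑ i : Fin s, if n = m + (i : ℤ) then ((α i : ℕ) : ZMod p) else 0 := by
  simp only [charDigit_prod, charDigit_pow, charDigit_rademacher, mul_ite, mul_one, mul_zero]

theorem charDigit_prod_rademacher_of_lt {s : ℕ} {m : ℤ} (α : Fin s → Fin p) {n : ℤ} (hn : n < m) :
    S.charDigit (∏ i : Fin s, S.rademacher (m + (i : ℤ)) ^ (α i : ℕ)) n = 0 := by
  rw [charDigit_prod_rademacher]
  exact Finset.sum_eq_zero fun i _ => if_neg (by omega)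

theorem charDigit_prod_rademacher_of_ge {s : ℕ} {m : ℤ} (α : Fin s → Fin p) {n : ℤ}
    (hn : m + s ≤ n) :
    S.charDigit (∏ i : Fin s, S.rademacher (m + (i : ℤ)) ^ (α i : ℕ)) n = 0 := by
  rw [charDigit_prod_rademacher]
  exact Finset.sum_eq_zero fun i _ => if_neg (by omega)

theorem charDigit_prod_rademacher_add {s : ℕ} (m : ℤ) (α : Fin s → Fin p) (i : Fin s) :
    S.charDigit (∏ i : Fin s, S.rademacher (m + (i : ℤ)) ^ (α i : ℕ)) (m + (i : ℤ)) =
      ((α i : ℕ) : ZMod p) := by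
  rw [charDigit_prod_rademacher, Finset.sum_eq_single i, if_pos rfl]
  · intro j _ hj
    refine if_neg fun h => hj (Fin.ext ?_)
    omega
  · exact fun h => absurd (Finset.mem_univ i) h

theorem charLetter_of_mem_periodicExtension {f : Fin p → Fin p} (hr : f 0 = 0)
    (hf : ∀ v, ∃ k, f^[k] v = 0) {χ : CharGroup G}
    (h : χ ∈ S.periodicExtension (S.treeSet (parentGraph f))) :
    S.charLetter χ 0 = f (S.charLetter χ (-1)) := by
  simp only [periodicExtension, Set.mem_iUnion] at h
  obtain ⟨s, -, α, ψ, hψ, rfl⟩ := h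
  simp only [add_comm _ (1 : ℤ)]
  have h1 (n : ℤ) (hn : n < 1) : S.charLetter
      (ψ * ∏ i : Fin s, S.rademacher (1 + (i : ℤ)) ^ (α i : ℕ)) n = S.charLetter ψ n := by
    rw [charLetter_eq_charLetter_iff, charDigit_mul, S.charDigit_prod_rademacher_of_lt α hn,
      add_zero]
  rw [h1 0 (by omega), h1 (-1) (by omega)]
  exact ((S.mem_treeSet_parentGraph hr hf ψ).1 hψ).1

theorem mem_periodicExtension {f : Fin p → Fin p} (hr : f 0 = 0)
    (hf : ∀ v, ∃ k, f^[k] v = 0) {χ : CharGroup G} {s : ℕ} (hs : 1 ≤ s) (hχ : χ ∈ S.ann s)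
    (h : S.charLetter χ 0 = f (S.charLetter χ (-1))) :
    χ ∈ S.periodicExtension (S.treeSet (parentGraph f)) := by
  simp only [periodicExtension, Set.mem_iUnion]
  -- The digits of `χ` with indices `1, …, s` are split off; those beyond `s - 1` vanish anyway.
  let α : Fin s → Fin p := fun i => S.charLetter χ (1 + (i : ℤ))
  let ρ : CharGroup G := ∏ i : Fin s, S.rademacher (1 + (i : ℤ)) ^ (α i : ℕ)
  refine ⟨s, hs, α, χ * ρ⁻¹, ?_, ?_⟩
  · have h1 (n : ℤ) (hn : n < 1) : S.charLetter (χ * ρ⁻¹) n = S.charLetter χ n := by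
      rw [charLetter_eq_charLetter_iff, charDigit_mul, charDigit_inv,
        S.charDigit_prod_rademacher_of_lt α hn, neg_zero, add_zero]
    rw [mem_treeSet_parentGraph S hr hf, h1 0 (by omega), h1 (-1) (by omega)]
    refine ⟨h, fun n hn => ?_⟩
    rw [charDigit_mul, charDigit_inv]
    by_cases h2 : n < 1 + s
    · obtain ⟨i, rfl⟩ : ∃ i : Fin s, n = 1 + (i : ℤ) :=
        ⟨⟨(n - 1).toNat, by omega⟩, by simp only; omega⟩
      rw [S.charDigit_prod_rademacher_add 1 α i, natCast_charLetter, add_neg_cancel]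
    · rw [S.charDigit_prod_rademacher_of_ge α (not_lt.1 h2), (S.mem_ann_iff χ s).1 hχ n (by omega),
        neg_zero, add_zero]
  · simp only [add_comm _ (1 : ℤ)]
    exact inv_mul_cancel_right _ _

theorem mem_image_iterate_charDilation (n : ℕ) (A : Set (CharGroup G)) (χ : CharGroup G) :
    χ ∈ S.charDilation^[n] '' A ↔ S.charDilation.symm^[n] χ ∈ A := by
  rw [Set.image_eq_preimage_of_inverse
    (Function.LeftInverse.iterate S.charDilation.symm_apply_apply n)
    (Function.LeftInverse.iterate S.charDilation.apply_symm_apply n)]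
  rfl

/-- A set of characters in `G_s^⊥` is generated by the tree of a parent map `f` as soon as it
consists of the characters whose digits follow `f`. -/
theorem treeGenerates_parentGraph {f : Fin p → Fin p} (hr : f 0 = 0)
    (hf : ∀ v, ∃ k, f^[k] v = 0) {s : ℕ} (hs : 1 ≤ s) {E : Set (CharGroup G)}
    (hEs : E ⊆ S.ann s)
    (hE : ∀ χ, χ ∈ E ↔ ∀ n : ℕ, S.charLetter χ n = f (S.charLetter χ (-1 + n))) :
    S.TreeGenerates (parentGraph f) E := by
  have hshift (χ : CharGroup G) (n : ℕ) (m : ℤ) :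
      S.charLetter (S.charDilation.symm^[n] χ) m = S.charLetter χ (m + n) := by
    rw [charLetter_eq_charLetter_iff, charDigit_iterate_symm]
  rw [TreeGenerates]
  ext χ
  simp only [Set.mem_iInter, mem_image_iterate_charDilation]
  constructor
  · intro h n
    refine S.mem_periodicExtension hr hf hs ?_ ?_
    · rw [mem_ann_iff]
      intro k hk
      rw [charDigit_iterate_symm]
      exact (S.mem_ann_iff χ s).1 (hEs h) _ (by omega)
    · rw [hshift, hshift, zero_add]
      exact (hE χ).1 h n
  · intro h
    rw [hE]
    intro n
    have h1 := S.charLetter_of_mem_periodicExtension hr hf (h n)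
    rwa [hshift, hshift, zero_add] at h1

/-! ### Elementary sets that carry refinable functions -/

/-- A `(1, M)`-elementary set contains exactly one coset of `G_{-1}^⊥` for every value of the digit
with index `-1`. -/
theorem IsElementarySet.exists_representatives {S : BasicSystem p G} {M : ℕ}
    {E : Set (CharGroup G)} (hE : S.IsElementarySet 1 M E) :
    ∃ ψ : Fin p → CharGroup G, (∀ i, S.charLetter (ψ i) (-1) = i) ∧
      ∀ χ, χ ∈ E ↔ ∀ n ≥ -1, S.charDigit χ n = S.charDigit (ψ (S.charLetter χ (-1))) n := by
  obtain ⟨b, hb, -⟩ := hE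
  have hdig (a : Fin 1 → Fin p) : S.charLetter (S.xi a * S.eta (b a)) (-1) = a 0 := by
    have h1 := S.charDigit_prod_rademacher_add (-1) a 0
    have h2 := S.charDigit_prod_rademacher_of_lt (m := 0) (b a) (n := -1) (by omega)
    simp only [zero_add] at h2
    simp only [charLetter_eq_iff, charDigit_mul, xi, eta, h2, add_zero]
    simpa using h1
  refine ⟨fun i => S.xi (fun _ => i) * S.eta (b fun _ => i), fun i => hdig _, fun χ => ?_⟩
  rw [hb, Set.mem_iUnion]
  constructor
  · rintro ⟨a, ha⟩
    rw [mem_coset_iff] at ha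
    have h1 : S.charLetter χ (-1) = a 0 := by
      rw [← hdig a, charLetter_eq_charLetter_iff]
      exact ha (-1) (by simp)
    have h2 : (fun _ : Fin 1 => S.charLetter χ (-1)) = a := by
      funext i
      rw [h1, Subsingleton.elim i 0]
    intro n hn
    simp only [h2]
    exact ha n (by simpa using hn)
  · intro h
    exact ⟨fun _ => S.charLetter χ (-1), (S.mem_coset_iff _ _ _).2 fun n hn =>
      h n (by simpa using hn)⟩

/-- If `E` is invariant under `χ ↦ χ𝒜⁻¹`, the digits of its elements follow a parent map. -/
theorem IsElementarySet.exists_parent {S : BasicSystem p G} {M : ℕ} {E : Set (CharGroup G)}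
    (hE : S.IsElementarySet 1 M E) (hEM : E ⊆ S.ann M)
    (hshift : ∀ χ ∈ E, S.charDilation.symm χ ∈ E) :
    ∃ f : Fin p → Fin p, f 0 = 0 ∧ (∀ i, f^[M + 1] i = 0) ∧ (∃ i, f^[M] i ≠ 0) ∧
      ∀ χ, χ ∈ E ↔ ∀ n : ℕ, S.charLetter χ n = f (S.charLetter χ (-1 + n)) := by
  obtain ⟨ψ, hψ, hmem⟩ := hE.exists_representatives
  have hψE (i : Fin p) : ψ i ∈ E := (hmem _).2 fun n _ => by rw [hψ]
  let f : Fin p → Fin p := fun i => S.charLetter (ψ i) 0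
  have hiter (χ : CharGroup G) (hχ : χ ∈ E) (n : ℕ) : S.charDilation.symm^[n] χ ∈ E := by
    induction n with
    | zero => exact hχ
    | succ n ih =>
      rw [Function.iterate_succ_apply']
      exact hshift _ ih
  have hfirst (χ : CharGroup G) (hχ : χ ∈ E) : S.charLetter χ 0 = f (S.charLetter χ (-1)) := by
    rw [charLetter_eq_charLetter_iff]
    exact (hmem χ).1 hχ 0 (by omega)
  have hrec (χ : CharGroup G) (hχ : χ ∈ E) (n : ℕ) :
      S.charLetter χ n = f (S.charLetter χ (-1 + n)) := by
    have h := hfirst _ (hiter χ hχ n)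
    have hs (m : ℤ) : S.charLetter (S.charDilation.symm^[n] χ) m = S.charLetter χ (m + n) := by
      rw [charLetter_eq_charLetter_iff, charDigit_iterate_symm]
    rwa [hs, hs, zero_add] at h
  have hpow (χ : CharGroup G) (h : ∀ n : ℕ, S.charLetter χ n = f (S.charLetter χ (-1 + n)))
      (n : ℕ) : S.charLetter χ (-1 + n) = f^[n] (S.charLetter χ (-1)) := by
    induction n with
    | zero => simp
    | succ n ih =>
      rw [Function.iterate_succ_apply', ← ih, ← h]
      congr 1
      push_cast
      ring
  have hzero (i : Fin p) : f^[M + 1] i = 0 := by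
    have h := hpow (ψ i) (hrec _ (hψE i)) (M + 1)
    rw [hψ] at h
    rw [← h, charLetter_eq_zero_iff]
    exact (S.mem_ann_iff _ _).1 (hEM (hψE i)) _ (by push_cast; omega)
  -- Shifting an element of `E` past its last digit produces an element of `G_{-1}^⊥` in `E`.
  have hroot : f 0 = 0 := by
    have h := hfirst _ (hiter _ (hψE 0) (M + 1))
    have hs (m : ℤ) (hm : -1 ≤ m) :
        S.charLetter (S.charDilation.symm^[M + 1] (ψ 0)) m = 0 := by
      rw [charLetter_eq_zero_iff, charDigit_iterate_symm]
      exact (S.mem_ann_iff _ _).1 (hEM (hψE 0)) _ (by push_cast; omega)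
    rw [hs 0 (by omega), hs (-1) le_rfl] at h
    exact h.symm
  refine ⟨f, hroot, hzero, ?_, fun χ => ⟨hrec χ, fun h => ?_⟩⟩
  · obtain ⟨b, -, -, -, -, -, hlevel⟩ := hE
    obtain ⟨χ, ⟨h1, h2⟩, hχ⟩ := hlevel M (by omega)
    refine ⟨S.charLetter χ (-1), ?_⟩
    rw [← hpow χ (hrec χ hχ), Ne, charLetter_eq_zero_iff]
    intro h3
    apply h2
    rw [SetLike.mem_coe, mem_ann_iff] at h1 ⊢
    intro n hn
    push_cast at h1 hn
    rcases (show n = -1 + M ∨ -1 + (M : ℤ) + 1 ≤ n by omega) with rfl | h4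
    · exact h3
    · exact h1 n h4
  · rw [hmem]
    intro n hn
    rw [← charLetter_eq_charLetter_iff]
    have h2 := hpow χ h (n + 1).toNat
    have h3 := hpow (ψ (S.charLetter χ (-1))) (hrec _ (hψE _)) (n + 1).toNat
    rw [hψ, ← h2, show -1 + ((n + 1).toNat : ℤ) = n by omega] at h3
    exact h3.symm

/-- The refinement equation makes the support of `φ̂` invariant under `χ ↦ χ𝒜⁻¹`. -/
theorem SolvesRefinement.charDilation_symm_mem {S : BasicSystem p G} {m₀ φhat : CharGroup G → ℂ}
    (h : S.SolvesRefinement m₀ φhat) {E : Set (CharGroup G)}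
    (habs : ∀ χ, ‖φhat χ‖ = E.indicator (fun _ => (1 : ℝ)) χ) {χ : CharGroup G} (hχ : χ ∈ E) :
    S.charDilation.symm χ ∈ E := by
  by_contra h1
  have h2 := habs (S.charDilation.symm χ)
  rw [Set.indicator_of_notMem h1, norm_eq_zero] at h2
  have h3 := habs χ
  rw [Set.indicator_of_mem hχ, h χ, h2, mul_zero, norm_zero] at h3
  exact zero_ne_one h3

end BasicSystem

theorem theorem4p1 {p : ℕ} [Fact p.Prime] (hp : 3 ≤ p)
    {G : Type*} [AddCommGroup G] [TopologicalSpace G] [IsTopologicalAddGroup G]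
    [LocallyCompactSpace G] (S : BasicSystem p G)
    {M : ℕ} (hM : 1 ≤ M) (E : Set (CharGroup G))
    (hEM : E ⊆ S.ann M) (hE : S.IsElementarySet 1 M E)
    (φhat : CharGroup G → ℂ) (hφ : φhat ∈ S.StepClass 1 M)
    (habs : ∀ χ, ‖φhat χ‖ = E.indicator (fun _ => (1 : ℝ)) χ)
    (m₀ : CharGroup G → ℂ) (hm₀ : S.IsElementaryMask 1 m₀)
    (href : S.SolvesRefinement m₀ φhat) :
    ∃ T : SimpleGraph (Fin p), T.IsTree ∧ HasHeight T (M + 2) ∧ S.TreeGenerates T E := by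
  obtain ⟨f, hroot, hzero, ⟨i, hi⟩, hmem⟩ :=
    hE.exists_parent hEM fun χ hχ => href.charDilation_symm_mem habs hχ
  have hf : ∀ v, ∃ k, f^[k] v = 0 := fun v => ⟨M + 1, hzero v⟩
  exact ⟨parentGraph f, parentGraph.isTree hroot hf, parentGraph.hasHeight hroot hzero hi,
    S.treeGenerates_parentGraph hroot hf hM hEM hmem⟩
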